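/- Let $\langle x,y\rangle_L=-x_0y_0+x_1y_1+x_2y_2+x_3y_3$ on $\mathbb R^{3,1}$, $\mathbb H^3=\{\langle x,x\rangle_L=-1,\ x_0>0\}$, and let $B^3(r)$ be the closed geodesic ball of radius $r$ about $(1,0,0,0)$. For $a>1/2$ put $K=\sqrt{a^2-1/4}$, $A(s)=\sqrt{a\cosh 2s+\tfrac12}$, $B(s)=\sqrt{a\cosh 2s-\tfrac12}$, $\varphi(s)=\int_0^s\frac{K}{A(t)^2B(t)}\,dt$ and $$\Phi_a(s,\theta)=\bigl(A\cosh\varphi,\ A\sinh\varphi,\ B\cos\theta,\ B\sin\theta\bigr)\in\mathbb H^3 ,\qquad (s,\theta)\in\mathbb R\times S^1 .$$ **Proposition.** Let $a>1/2$. 1. There is exactly one $s_0=s_0(a)>0$ such that $\Sigma_a=\Phi_a|_{[-s_0,s_0]\times S^1}$ is a free boundary minimal surface in $B^3(r(a))$, where $r(a)=\operatorname{arcosh}(A(s_0)\cosh\varphi(s_0))$: that is, a smooth immersion with zero mean curvature, with interior in the open ball and boundary on $\partial B^3(r(a))$, which it meets orthogonally. 2. Let $\nu$ be the unit normal of $\Phi_a$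 in $\mathbb H^3$ with positive $x_2$-component at $(s,\theta)=(0,0)$, and let $L_{1j}=x_1\partial_j-x_j\partial_1$ ($j=2,3$) be the Killing fields generating the rotations of the $(x_1,x_j)$-planes. Then for all $s,\theta$ $$\langle L_{12},\nu\rangle_L=f_*(s)\cos\theta,\quad \langle L_{13},\nu\rangle_L=f_*(s)\sin\theta,\quad f_*(s)=\frac{K\sinh\varphi(s)+a\,B(s)\sinh(2s)\cosh\varphi(s)}{A(s)B(s)} .$$ 3. Let $L_{\Sigma_a}=\Delta_g+|\mathrm{II}|^2-2$ be the Jacobi operator, with $g$ the induced metric, $\Delta_g=\operatorname{div}_g\nabla$ and $\mathrm{II}$ the second fundamental form of $\Sigma_a$ in $\mathbb H^3$, and let $\eta$ be the outward unit conormal along $\partial\Sigma_a$. For every $2\le n\le\infty$, the real vector space of functions $u$ of class $C^n$ on $[-s_0,s_0]\times S^1$ (up to the boundary) that lie in the angular Fourier mode $|k|=1$, i.e. $u(s,\theta)=f(s)\cos\theta+g(s)\sin\theta$, and satisfy $$L_{\Sigma_a}u=0\ \text{ in the interior of }\Sigma_a,\qquad \partial_\eta u=\coth(r(a))\,u\ \text{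 on }\partial\Sigma_a,$$ has dimension exactly $2$ and is spanned by $\langle L_{12},\nu\rangle_L$ and $\langle L_{13},\nu\rangle_L$. -/

import Mathlib

open Real Set
open scoped ContDiff

noncomputable section

namespace HypCatenoid

/-! ### Minkowski space and hyperbolic space -/

/-- The coordinate space underlying Minkowski space `ℝ^{3,1}`, coordinates `x₀, x₁, x₂, x₃`. -/
abbrev Mink : Type := Fin 4 → ℝ

/-- The Lorentzian form `⟨x, y⟩_L = -x₀y₀ + x₁y₁ + x₂y₂ + x₃y₃`. -/
def lorentz (x y : Mink) : ℝ := -(x 0 * y 0) + x 1 * y 1 + x 2 * y 2 + x 3 * y 3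

/-- The hyperboloid model of `ℍ³`. -/
def hyperbolicSpace : Set Mink := {x | lorentz x x = -1 ∧ 0 < x 0}

/-- The centre `p₀ = (1, 0, 0, 0)`; as a vector it is also the coordinate field `∂₀`. -/
def origin : Mink := Pi.single 0 1

/-- Geodesic distance on `ℍ³`: `cosh d(x, y) = -⟨x, y⟩_L`. -/
def hypDist (x y : Mink) : ℝ := arcosh (-lorentz x y)

/-- The open geodesic ball of radius `r` centred at `p₀`. -/
def geodesicBall (r : ℝ) : Set Mink := {x | x ∈ hyperbolicSpace ∧ hypDist origin x < r}

/-- The geodesic sphere of radius `r` centred at `p₀`, i.e. the boundary `∂B³(r)`. -/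
def geodesicSphere (r : ℝ) : Set Mink := {x | x ∈ hyperbolicSpace ∧ hypDist origin x = r}

/-- The unit normal in `ℍ³` at the point `x` of the geodesic sphere of radius `r` centred at `p₀`:
the projection of `-∂₀` to `T_x ℍ³`, divided by `sinh r`. -/
def sphereNormal (r : ℝ) (x : Mink) : Mink := (sinh r)⁻¹ • (-origin + x 0 • x)

/-- The Lorentzian cross product of three vectors: the vector `w` with
`⟨w, v⟩_L = det (v, x, y, z)` (rows) for every `v`. -/
def lorentzCross (x y z : Mink) : Mink := fun k =>
  (if k = 0 then -1 else 1) * Matrix.det (Matrix.of ![Pi.single k 1, x, y, z])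

theorem lorentz_lorentzCross (x y z v : Mink) :
    lorentz (lorentzCross x y z) v = Matrix.det (Matrix.of ![v, x, y, z]) := by
  simp [lorentz, lorentzCross, Matrix.det_succ_row_zero, Fin.sum_univ_succ]
  ring

/-- The Killing field `L_{ij} = x_i ∂_j - x_j ∂_i` generating the rotations of the
`(x_i, x_j)`-plane (for spatial indices `i ≠ j`). -/
def rotationField (i j : Fin 4) (x : Mink) : Mink :=
  x i • (Pi.single j 1 : Mink) - x j • (Pi.single i 1 : Mink)

/-! ### Geometry of a parametrized surface `X (s, θ)` in `ℍ³` -/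

/-- Coordinate derivatives: `pd 0 = ∂_s` and `pd 1 = ∂_θ`. -/
def pd {E : Type*} [NormedAddCommGroup E] [NormedSpace ℝ E] (i : Fin 2)
    (f : ℝ → ℝ → E) : ℝ → ℝ → E := fun s θ =>
  if i = 0 then deriv (fun t => f t θ) s else deriv (fun t => f s t) θ

/-- First fundamental form `g_{ij} = ⟨∂_i X, ∂_j X⟩_L`. -/
def firstForm (X : ℝ → ℝ → Mink) (s θ : ℝ) : Matrix (Fin 2) (Fin 2) ℝ :=
  Matrix.of fun i j => lorentz (pd i X s θ) (pd j X s θ)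

/-- The unit normal `ν` of the surface in `ℍ³`: the normalized cross product of
`X, ∂_s X, ∂_θ X` (so it is orthogonal to the surface and to the position vector). -/
def unitNormal (X : ℝ → ℝ → Mink) (s θ : ℝ) : Mink :=
  let w := lorentzCross (X s θ) (pd 0 X s θ) (pd 1 X s θ)
  (√(lorentz w w))⁻¹ • w

/-- Second fundamental form `h_{ij} = ⟨∂_i ∂_j X, ν⟩_L` of the surface in `ℍ³`. -/
def secondForm (X : ℝ → ℝ → Mink) (s θ : ℝ) : Matrix (Fin 2) (Fin 2) ℝ :=
  Matrix.of fun i j => lorentz (pd i (pd j X) s θ) (unitNormal X s θ)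

/-- The shape operator `g⁻¹ h`. -/
def shapeOperator (X : ℝ → ℝ → Mink) (s θ : ℝ) : Matrix (Fin 2) (Fin 2) ℝ :=
  (firstForm X s θ)⁻¹ * secondForm X s θ

/-- Mean curvature (sum of the principal curvatures). -/
def meanCurvature (X : ℝ → ℝ → Mink) (s θ : ℝ) : ℝ := (shapeOperator X s θ).trace

/-- Squared norm of the second fundamental form, `|II|² = g^{ik} g^{jl} h_{ij} h_{kl}`. -/
def secondFormNormSq (X : ℝ → ℝ → Mink) (s θ : ℝ) : ℝ :=
  (shapeOperator X s θ * shapeOperator X s θ).trace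

/-- The Laplace–Beltrami operator `Δ_g u = (det g)^{-1/2} ∂_i ((det g)^{1/2} g^{ij} ∂_j u)` of the
induced metric (`Δ_g = div ∇`). -/
def laplaceBeltrami (X : ℝ → ℝ → Mink) (u : ℝ → ℝ → ℝ) (s θ : ℝ) : ℝ :=
  (√(firstForm X s θ).det)⁻¹ *
    ∑ i, pd i (fun s' θ' => √(firstForm X s' θ').det *
      ∑ j, (firstForm X s' θ')⁻¹ i j * pd j u s' θ') s θ

/-- The Jacobi operator `L u = Δ_g u + (|II|² - 2) u` of a minimal surface in `ℍ³`. -/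
def jacobiOperator (X : ℝ → ℝ → Mink) (u : ℝ → ℝ → ℝ) (s θ : ℝ) : ℝ :=
  laplaceBeltrami X u s θ + (secondFormNormSq X s θ - 2) * u s θ

/-- The derivative `∂_η u` in the direction of the outward unit conormal `η` at the boundary point
`(s, θ)` of the annulus `[-s₀, s₀] × S¹`, where `s = ε s₀` with `ε = 1` or `ε = -1`. Here
`η = ε ∇s / |∇s|`, so that `∂_η u = ε g^{0j} ∂_j u / √g^{00}`. The derivative in `s` is one-sided,
taken from inside the annulus. -/
def conormalDeriv (X : ℝ → ℝ → Mink) (s₀ ε : ℝ) (u : ℝ → ℝ → ℝ) (θ : ℝ) : ℝ :=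
  let s := ε * s₀
  let gi := (firstForm X s θ)⁻¹
  ε * (gi 0 0 * derivWithin (fun t => u t θ) (Icc (-s₀) s₀) s
    + gi 0 1 * deriv (fun t => u s t) θ) / √(gi 0 0)

/-- The restriction of `X` (assumed `2π`-periodic in `θ`) to `[-s₀, s₀] × S¹` is a free boundary
minimal surface in the geodesic ball of radius `r` centred at `p₀`: a smooth immersion with zero
mean curvature, with interior in the open ball and boundary on the bounding sphere, which it meets
orthogonally. -/
structure IsFreeBoundaryMinimal (X : ℝ → ℝ → Mink) (s₀ r : ℝ) : Prop where
  smooth : ContDiff ℝ ∞ (fun p : ℝ × ℝ => X p.1 p.2)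
  immersed : ∀ s ∈ Icc (-s₀) s₀, ∀ θ, 0 < (firstForm X s θ).det
  minimal : ∀ s ∈ Icc (-s₀) s₀, ∀ θ, meanCurvature X s θ = 0
  interior : ∀ s ∈ Ioo (-s₀) s₀, ∀ θ, X s θ ∈ geodesicBall r
  boundary : ∀ s ∈ ({-s₀, s₀} : Set ℝ), ∀ θ, X s θ ∈ geodesicSphere r
  orthogonal : ∀ s ∈ ({-s₀, s₀} : Set ℝ), ∀ θ,
    lorentz (unitNormal X s θ) (sphereNormal r (X s θ)) = 0

/-! ### The spherical catenoids -/

/-- `A(s) = √(a cosh 2s + 1/2)`. -/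
def profA (a s : ℝ) : ℝ := √(a * cosh (2 * s) + 1 / 2)

/-- `B(s) = √(a cosh 2s - 1/2)`. -/
def profB (a s : ℝ) : ℝ := √(a * cosh (2 * s) - 1 / 2)

/-- `K(a) = √(a² - 1/4)`. -/
def profK (a : ℝ) : ℝ := √(a ^ 2 - 1 / 4)

/-- `φ(s) = ∫₀ˢ K / (A² B)`. -/
def profPhi (a s : ℝ) : ℝ := ∫ t in (0 : ℝ)..s, profK a / (profA a t ^ 2 * profB a t)

/-- The spherical catenoid
`Φ_a(s, θ) = (A cosh φ, A sinh φ, B cos θ, B sin θ)`. -/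
def catenoid (a s θ : ℝ) : Mink :=
  ![profA a s * cosh (profPhi a s), profA a s * sinh (profPhi a s),
    profB a s * cos θ, profB a s * sin θ]

/-- The boundary radius `arcosh (A(s₀) cosh φ(s₀))` of the piece `|s| ≤ s₀`. -/
def bdryRadius (a s₀ : ℝ) : ℝ := arcosh (profA a s₀ * cosh (profPhi a s₀))

/-- `s₀ > 0` is a parameter at which the piece `|s| ≤ s₀` of the catenoid is a free boundary
minimal surface in the geodesic ball of the corresponding boundary radius. -/
def IsCritical (a s₀ : ℝ) : Prop :=
  0 < s₀ ∧ IsFreeBoundaryMinimal (catenoid a) s₀ (bdryRadius a s₀)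

/-- `f_*(s) = (K sinh φ + a B sinh(2s) cosh φ) / (A B)`. -/
def fStar (a s : ℝ) : ℝ :=
  (profK a * sinh (profPhi a s) + a * profB a s * sinh (2 * s) * cosh (profPhi a s)) /
    (profA a s * profB a s)

/-! ### The Robin eigenvalue problem in angular mode one -/

/-- The annulus `[-s₀, s₀] × S¹`, which parametrizes `Σ_a`. -/
abbrev Annulus (s₀ : ℝ) : Type := Icc (-s₀) s₀ × Real.Angle

open Classical in
/-- A function on the annulus in the coordinates `(s, θ)`, `θ ∈ ℝ` (zero for `|s| > s₀`; those
values are never used). -/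
def inCoords {s₀ : ℝ} (u : Annulus s₀ → ℝ) (s θ : ℝ) : ℝ :=
  if h : s ∈ Icc (-s₀) s₀ then u (⟨s, h⟩, (θ : Real.Angle)) else 0

/-- `u` is of class `C^n` on the closed annulus (up to the boundary). -/
def IsCn {s₀ : ℝ} (n : ℕ∞) (u : Annulus s₀ → ℝ) : Prop :=
  ContDiffOn ℝ n (fun p : ℝ × ℝ => inCoords u p.1 p.2) (Icc (-s₀) s₀ ×ˢ (univ : Set ℝ))

/-- `u` lies in the angular Fourier mode `|k| = 1`: `u(s, θ) = f(s) cos θ + g(s) sin θ`. -/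
def IsModeOne {s₀ : ℝ} (u : Annulus s₀ → ℝ) : Prop :=
  ∃ f g : Icc (-s₀) s₀ → ℝ, ∀ p : Annulus s₀, u p = f p.1 * p.2.cos + g p.1 * p.2.sin

/-- The functions `u` of class `C^n` on the annulus, in the angular Fourier mode `|k| = 1`, with
`L u = lam u` in the interior and `∂_η u = coth(r) u` on the boundary, where `r = r(a)` is the
boundary radius. -/
def robinEigenspace (a s₀ lam : ℝ) (n : ℕ∞) : Set (Annulus s₀ → ℝ) :=
  {u | IsCn n u ∧ IsModeOne u ∧
    (∀ s ∈ Ioo (-s₀) s₀, ∀ θ,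
      jacobiOperator (catenoid a) (inCoords u) s θ = lam * inCoords u s θ) ∧
    (∀ ε ∈ ({-1, 1} : Set ℝ), ∀ θ,
      conormalDeriv (catenoid a) s₀ ε (inCoords u) θ =
        cosh (bdryRadius a s₀) / sinh (bdryRadius a s₀) * inCoords u (ε * s₀) θ)}

/-- The function `⟨L_{ij}, ν⟩_L` on the catenoid, in coordinates. -/
def killingJacobi (a : ℝ) (i j : Fin 4) (s θ : ℝ) : ℝ :=
  lorentz (rotationField i j (catenoid a s θ)) (unitNormal (catenoid a) s θ)

/-- The function `⟨L_{ij}, ν⟩_L` on the annulus (`catenoid a` is `2π`-periodic in `θ`, so the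
choice of the representative of the angle is irrelevant). -/
def killingJacobiOn (a s₀ : ℝ) (i j : Fin 4) : Annulus s₀ → ℝ :=
  fun p => killingJacobi a i j p.1 p.2.toReal

end HypCatenoid

end

namespace HypCatenoid

/-! Everything is read off the time coordinates of the frame: `height` is `x₀`, `normalHeight` is
`ν₀`, and the time coordinate of `∂_s Φ_a` is exactly `f_*`. Since `s` is arc length on the
meridians and their principal curvature is `κ = K / B²`, the structure equations give `x₀' = f_*`,
`f_*' = x₀ + κ ν₀` and `ν₀' = -κ f_*`; expanding `∂₀` in the orthonormal frame gives `x₀² = 1 + f_*²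
+ ν₀²`.

Existence and uniqueness of `s₀`: the surface meets the sphere orthogonally iff `ν₀ = 0`
(`isCritical_iff`). As `f_* > 0` for `s > 0`, `ν₀` decreases strictly from a positive value, and it
becomes negative (`exists_normalHeight_neg`). The other requirements hold automatically, because
`x₀` is even and increases with `|s|`.

Robin problem: at `s₀` the identities become `f_* = sinh r` and `f_*' = x₀ = cosh r`, so `f_*`
satisfies the boundary condition. In mode one the Jacobi equation is a second order linear ODE
solved by `f_*`. For another solution `F`, Abel's formula makes `B (F f_*' - F' f_*)` constant; it
vanishes at `s₀`, so `F` is a multiple of `f_*` (`eq_mul_fStar_of_modeOneJacobi_eq_zero`). The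
cosine and sine coefficients then give one free constant each. -/

/-! ### The profile functions `A`, `B`, `K`, `φ`. -/

theorem one_lt_profA_sq {a : ℝ} (ha : 1 / 2 < a) (s : ℝ) : 1 < a * cosh (2 * s) + 1 / 2 := by
  nlinarith [one_le_cosh (2 * s)]

theorem profB_sq_pos {a : ℝ} (ha : 1 / 2 < a) (s : ℝ) : 0 < a * cosh (2 * s) - 1 / 2 := by
  nlinarith [one_le_cosh (2 * s)]

theorem profA_sq {a : ℝ} (ha : 1 / 2 < a) (s : ℝ) :
    profA a s ^ 2 = a * cosh (2 * s) + 1 / 2 :=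
  sq_sqrt (zero_lt_one.trans (one_lt_profA_sq ha s)).le

theorem profB_sq {a : ℝ} (ha : 1 / 2 < a) (s : ℝ) :
    profB a s ^ 2 = a * cosh (2 * s) - 1 / 2 :=
  sq_sqrt (profB_sq_pos ha s).le

theorem profK_sq {a : ℝ} (ha : 1 / 2 < a) : profK a ^ 2 = a ^ 2 - 1 / 4 :=
  sq_sqrt (by nlinarith)

theorem profA_pos {a : ℝ} (ha : 1 / 2 < a) (s : ℝ) : 0 < profA a s :=
  sqrt_pos.2 (zero_lt_one.trans (one_lt_profA_sq ha s))

theorem profB_pos {a : ℝ} (ha : 1 / 2 < a) (s : ℝ) : 0 < profB a s :=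
  sqrt_pos.2 (profB_sq_pos ha s)

theorem profK_pos {a : ℝ} (ha : 1 / 2 < a) : 0 < profK a :=
  sqrt_pos.2 (by nlinarith)

theorem profA_sq_eq_profB_sq_add_one {a : ℝ} (ha : 1 / 2 < a) (s : ℝ) :
    profA a s ^ 2 = profB a s ^ 2 + 1 := by
  rw [profA_sq ha, profB_sq ha]; ring

/-- With `A² = B² + 1` and `cosh² = 1 + sinh²`, this is the relation behind the unit speed of the
meridians, the unit length of `ν` and the Jacobi equation. -/
theorem profA_sq_mul_profB_sq {a : ℝ} (ha : 1 / 2 < a) (s : ℝ) :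
    profA a s ^ 2 * profB a s ^ 2 = profK a ^ 2 + (a * sinh (2 * s)) ^ 2 := by
  rw [profA_sq ha, profB_sq ha, profK_sq ha]
  linear_combination a ^ 2 * cosh_sq (2 * s)

theorem contDiff_cosh_two_mul : ContDiff ℝ ∞ (fun s : ℝ => cosh (2 * s)) :=
  contDiff_cosh.comp (contDiff_const.mul contDiff_id)

theorem contDiff_profA {a : ℝ} (ha : 1 / 2 < a) : ContDiff ℝ ∞ (profA a) :=
  ((contDiff_const.mul contDiff_cosh_two_mul).add contDiff_const).sqrt
    fun s => (zero_lt_one.trans (one_lt_profA_sq ha s)).ne'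

theorem contDiff_profB {a : ℝ} (ha : 1 / 2 < a) : ContDiff ℝ ∞ (profB a) :=
  ((contDiff_const.mul contDiff_cosh_two_mul).sub contDiff_const).sqrt
    fun s => (profB_sq_pos ha s).ne'

theorem hasDerivAt_cosh_two_mul (s : ℝ) :
    HasDerivAt (fun s : ℝ => cosh (2 * s)) (sinh (2 * s) * 2) s := by
  simpa using ((hasDerivAt_id s).const_mul 2).cosh

theorem hasDerivAt_sinh_two_mul (s : ℝ) :
    HasDerivAt (fun s : ℝ => sinh (2 * s)) (cosh (2 * s) * 2) s := by
  simpa using ((hasDerivAt_id s).const_mul 2).sinh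

theorem hasDerivAt_profA {a : ℝ} (ha : 1 / 2 < a) (s : ℝ) :
    HasDerivAt (profA a) (a * sinh (2 * s) / profA a s) s := by
  have h := (((hasDerivAt_cosh_two_mul s).const_mul a).add_const (1 / 2)).sqrt
    (zero_lt_one.trans (one_lt_profA_sq ha s)).ne'
  refine h.congr_deriv ?_
  change _ / (2 * profA a s) = _
  have := (profA_pos ha s).ne'
  field_simp

theorem hasDerivAt_profB {a : ℝ} (ha : 1 / 2 < a) (s : ℝ) :
    HasDerivAt (profB a) (a * sinh (2 * s) / profB a s) s := by
  have h := (((hasDerivAt_cosh_two_mul s).const_mul a).sub_const (1 / 2)).sqrt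
    (profB_sq_pos ha s).ne'
  refine h.congr_deriv ?_
  change _ / (2 * profB a s) = _
  have := (profB_pos ha s).ne'
  field_simp

theorem contDiff_profPhi_integrand {a : ℝ} (ha : 1 / 2 < a) :
    ContDiff ℝ ∞ (fun t => profK a / (profA a t ^ 2 * profB a t)) :=
  contDiff_const.div (((contDiff_profA ha).pow 2).mul (contDiff_profB ha))
    fun t => (mul_pos (pow_pos (profA_pos ha t) 2) (profB_pos ha t)).ne'

theorem hasDerivAt_profPhi {a : ℝ} (ha : 1 / 2 < a) (s : ℝ) :
    HasDerivAt (profPhi a) (profK a / (profA a s ^ 2 * profB a s)) s :=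
  (contDiff_profPhi_integrand ha).continuous.integral_hasStrictDerivAt 0 s |>.hasDerivAt

theorem contDiff_profPhi {a : ℝ} (ha : 1 / 2 < a) : ContDiff ℝ ∞ (profPhi a) := by
  rw [contDiff_infty_iff_deriv]
  refine ⟨fun s => (hasDerivAt_profPhi ha s).differentiableAt, ?_⟩
  rw [show deriv (profPhi a) = _ from funext fun s => (hasDerivAt_profPhi ha s).deriv]
  exact contDiff_profPhi_integrand ha

theorem profPhi_zero (a : ℝ) : profPhi a 0 = 0 := by simp [profPhi]

theorem profA_neg (a s : ℝ) : profA a (-s) = profA a s := by simp [profA]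

theorem profB_neg (a s : ℝ) : profB a (-s) = profB a s := by simp [profB]

theorem profPhi_neg (a s : ℝ) : profPhi a (-s) = -profPhi a s := by
  have h := intervalIntegral.integral_comp_neg (a := 0) (b := s)
    (fun t => profK a / (profA a t ^ 2 * profB a t))
  simp only [profA_neg, profB_neg, neg_zero] at h
  rw [profPhi, intervalIntegral.integral_symm, ← h, profPhi]

theorem strictMono_profPhi {a : ℝ} (ha : 1 / 2 < a) : StrictMono (profPhi a) :=
  strictMono_of_hasDerivAt_pos (hasDerivAt_profPhi ha) fun s =>
    div_pos (profK_pos ha) (mul_pos (pow_pos (profA_pos ha s) 2) (profB_pos ha s))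

theorem profPhi_pos {a : ℝ} (ha : 1 / 2 < a) {s : ℝ} (hs : 0 < s) : 0 < profPhi a s :=
  profPhi_zero a ▸ strictMono_profPhi ha hs

/-! ### Time coordinates of the position and the normal, and their derivatives. -/

/-- The time coordinate `x₀ = A cosh φ` of the catenoid. -/
noncomputable def height (a s : ℝ) : ℝ := profA a s * cosh (profPhi a s)

/-- The time coordinate `ν₀` of the unit normal of the catenoid. -/
noncomputable def normalHeight (a s : ℝ) : ℝ :=
  profK a / profA a s * cosh (profPhi a s)
    - a * sinh (2 * s) / (profA a s * profB a s) * sinh (profPhi a s)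

theorem fStar_neg (a s : ℝ) : fStar a (-s) = -fStar a s := by
  simp only [fStar, profA_neg, profB_neg, profPhi_neg, mul_neg, sinh_neg, cosh_neg]
  ring

theorem fStar_pos {a : ℝ} (ha : 1 / 2 < a) {s : ℝ} (hs : 0 < s) : 0 < fStar a s := by
  have hA := profA_pos ha s
  have hB := profB_pos ha s
  have hK := profK_pos ha
  have h1 := sinh_pos_iff.2 (profPhi_pos ha hs)
  have h2 : 0 < sinh (2 * s) := sinh_pos_iff.2 (by linarith)
  have h3 := cosh_pos (profPhi a s)
  have : 0 < a := by linarith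
  unfold fStar
  positivity

theorem height_neg (a s : ℝ) : height a (-s) = height a s := by
  simp [height, profA_neg, profPhi_neg]

theorem normalHeight_neg (a s : ℝ) : normalHeight a (-s) = normalHeight a s := by
  simp only [normalHeight, profA_neg, profB_neg, profPhi_neg, mul_neg, sinh_neg, cosh_neg]
  ring

theorem hasDerivAt_height {a : ℝ} (ha : 1 / 2 < a) (s : ℝ) :
    HasDerivAt (height a) (fStar a s) s := by
  refine ((hasDerivAt_profA ha s).mul (hasDerivAt_profPhi ha s).cosh).congr_deriv ?_
  have hA := (profA_pos ha s).ne'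
  have hB := (profB_pos ha s).ne'
  rw [fStar]
  field_simp
  ring

/-- Time component of the Weingarten equation `∂_s ν = -κ ∂_s Φ_a`, with `κ = K / B²`. -/
theorem hasDerivAt_normalHeight {a : ℝ} (ha : 1 / 2 < a) (s : ℝ) :
    HasDerivAt (normalHeight a) (-(profK a / profB a s ^ 2) * fStar a s) s := by
  have hA := (profA_pos ha s).ne'
  have hB := (profB_pos ha s).ne'
  have hφ := hasDerivAt_profPhi ha s
  refine ((((hasDerivAt_const s (profK a)).div (hasDerivAt_profA ha s) hA).mul hφ.cosh).sub
    ((((hasDerivAt_sinh_two_mul s).const_mul a).div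
      ((hasDerivAt_profA ha s).mul (hasDerivAt_profB ha s)) (mul_ne_zero hA hB)).mul
      hφ.sinh)).congr_deriv ?_
  have hAB := profA_sq_eq_profB_sq_add_one ha s
  have hABK := profA_sq_mul_profB_sq ha s
  have hc : a * cosh (2 * s) = profB a s ^ 2 + 1 / 2 := by rw [profB_sq ha]; ring
  simp only [fStar, Pi.mul_apply, Pi.div_apply]
  -- With the transcendental quantities replaced by independent letters, the goal is a rational
  -- identity modulo the relations `hAB`, `hABK`, `hc`.
  generalize profA a s = A at *
  generalize profB a s = B at *
  generalize profK a = K at *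
  generalize sinh (profPhi a s) = T at *
  generalize cosh (profPhi a s) = C at *
  generalize sinh (2 * s) = S at *
  generalize cosh (2 * s) = c at *
  field_simp
  grind

/-- Time component of the Gauss formula `∂_s ∂_s Φ_a = Φ_a + κ ν`. -/
theorem hasDerivAt_fStar {a : ℝ} (ha : 1 / 2 < a) (s : ℝ) :
    HasDerivAt (fStar a) (height a s + profK a / profB a s ^ 2 * normalHeight a s) s := by
  have hA := (profA_pos ha s).ne'
  have hB := (profB_pos ha s).ne'
  have hφ := hasDerivAt_profPhi ha s
  refine (((hφ.sinh.const_mul (profK a)).add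
    ((((hasDerivAt_profB ha s).const_mul a).mul (hasDerivAt_sinh_two_mul s)).mul hφ.cosh)).div
      ((hasDerivAt_profA ha s).mul (hasDerivAt_profB ha s)) (mul_ne_zero hA hB)).congr_deriv ?_
  have hAB := profA_sq_eq_profB_sq_add_one ha s
  have hABK := profA_sq_mul_profB_sq ha s
  have hc : a * cosh (2 * s) = profB a s ^ 2 + 1 / 2 := by rw [profB_sq ha]; ring
  simp only [height, normalHeight, Pi.mul_apply, Pi.add_apply]
  generalize profA a s = A at *
  generalize profB a s = B at *
  generalize profK a = K at *
  generalize sinh (profPhi a s) = T at *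
  generalize cosh (profPhi a s) = C at *
  generalize sinh (2 * s) = S at *
  generalize cosh (2 * s) = c at *
  field_simp
  grind

/-- This is `⟨∂₀, ∂₀⟩_L = -1` expanded in the frame `Φ_a`, `∂_s Φ_a`, `∂_θ Φ_a / B`, `ν`; the `θ`
direction has no time component. -/
theorem height_sq {a : ℝ} (ha : 1 / 2 < a) (s : ℝ) :
    height a s ^ 2 = 1 + fStar a s ^ 2 + normalHeight a s ^ 2 := by
  have hA := (profA_pos ha s).ne'
  have hB := (profB_pos ha s).ne'
  have hAB := profA_sq_eq_profB_sq_add_one ha s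
  have hABK := profA_sq_mul_profB_sq ha s
  have hC := cosh_sq (profPhi a s)
  simp only [height, fStar, normalHeight]
  generalize profA a s = A at *
  generalize profB a s = B at *
  generalize profK a = K at *
  generalize sinh (profPhi a s) = T at *
  generalize cosh (profPhi a s) = C at *
  generalize sinh (2 * s) = S at *
  field_simp
  grind

/-! ### The moving frame and the fundamental forms. -/

/-- The coordinate field `∂_s Φ_a`. -/
noncomputable def meridianField (a s θ : ℝ) : Mink :=
  ![fStar a s,
    a * sinh (2 * s) / profA a s * sinh (profPhi a s)
      + profK a / (profA a s * profB a s) * cosh (profPhi a s),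
    a * sinh (2 * s) / profB a s * cos θ, a * sinh (2 * s) / profB a s * sin θ]

/-- The coordinate field `∂_θ Φ_a`. -/
noncomputable def parallelField (a s θ : ℝ) : Mink :=
  ![0, 0, profB a s * -sin θ, profB a s * cos θ]

/-- The unit normal of the catenoid in closed form. -/
noncomputable def catenoidNormal (a s θ : ℝ) : Mink :=
  ![normalHeight a s,
    profK a / profA a s * sinh (profPhi a s)
      - a * sinh (2 * s) / (profA a s * profB a s) * cosh (profPhi a s),
    profK a / profB a s * cos θ, profK a / profB a s * sin θ]

theorem hasDerivAt_vecFour {f₀ f₁ f₂ f₃ : ℝ → ℝ} {d₀ d₁ d₂ d₃ s : ℝ} (h₀ : HasDerivAt f₀ d₀ s)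
    (h₁ : HasDerivAt f₁ d₁ s) (h₂ : HasDerivAt f₂ d₂ s) (h₃ : HasDerivAt f₃ d₃ s) :
    HasDerivAt (fun t => (![f₀ t, f₁ t, f₂ t, f₃ t] : Mink)) ![d₀, d₁, d₂, d₃] s := by
  rw [hasDerivAt_pi]
  intro i
  fin_cases i <;> assumption

theorem pd_zero_catenoid {a : ℝ} (ha : 1 / 2 < a) : pd 0 (catenoid a) = meridianField a := by
  funext s θ
  have hB := hasDerivAt_profB ha s
  refine (hasDerivAt_vecFour (hasDerivAt_height ha s)
    (((hasDerivAt_profA ha s).mul (hasDerivAt_profPhi ha s).sinh).congr_deriv ?_)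
    (hB.mul_const (cos θ)) (hB.mul_const (sin θ))).deriv
  have hA := (profA_pos ha s).ne'
  have hB := (profB_pos ha s).ne'
  field_simp

theorem pd_one_catenoid (a : ℝ) : pd 1 (catenoid a) = parallelField a := by
  funext s θ
  exact (hasDerivAt_vecFour (hasDerivAt_const θ _) (hasDerivAt_const θ _)
    ((hasDerivAt_cos θ).const_mul _) ((hasDerivAt_sin θ).const_mul _)).deriv

theorem pd_one_parallelField (a s θ : ℝ) :
    pd 1 (parallelField a) s θ = ![0, 0, profB a s * -cos θ, profB a s * -sin θ] :=
  (hasDerivAt_vecFour (hasDerivAt_const θ _) (hasDerivAt_const θ _)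
    ((hasDerivAt_sin θ).neg.const_mul _) ((hasDerivAt_cos θ).const_mul _)).deriv

theorem pd_zero_parallelField {a : ℝ} (ha : 1 / 2 < a) (s θ : ℝ) :
    pd 0 (parallelField a) s θ =
      ![0, 0, a * sinh (2 * s) / profB a s * -sin θ, a * sinh (2 * s) / profB a s * cos θ] :=
  (hasDerivAt_vecFour (hasDerivAt_const s _) (hasDerivAt_const s _)
    ((hasDerivAt_profB ha s).mul_const _) ((hasDerivAt_profB ha s).mul_const _)).deriv

theorem pd_one_meridianField (a s θ : ℝ) :
    pd 1 (meridianField a) s θ =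
      ![0, 0, a * sinh (2 * s) / profB a s * -sin θ, a * sinh (2 * s) / profB a s * cos θ] :=
  (hasDerivAt_vecFour (hasDerivAt_const θ _) (hasDerivAt_const θ _)
    ((hasDerivAt_cos θ).const_mul _) ((hasDerivAt_sin θ).const_mul _)).deriv

theorem hasDerivAt_deriv_profB {a : ℝ} (ha : 1 / 2 < a) (s : ℝ) :
    HasDerivAt (fun s => a * sinh (2 * s) / profB a s)
      (profB a s + profK a ^ 2 / profB a s ^ 3) s := by
  have hA := (profA_pos ha s).ne'
  have hB := (profB_pos ha s).ne'
  refine (((hasDerivAt_sinh_two_mul s).const_mul a).div (hasDerivAt_profB ha s) hB).congr_deriv ?_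
  have hAB := profA_sq_eq_profB_sq_add_one ha s
  have hABK := profA_sq_mul_profB_sq ha s
  have hc : a * cosh (2 * s) = profB a s ^ 2 + 1 / 2 := by rw [profB_sq ha]; ring
  generalize profA a s = A at *
  generalize profB a s = B at *
  generalize profK a = K at *
  generalize sinh (2 * s) = S at *
  generalize cosh (2 * s) = c at *
  field_simp
  grind

/-- Gauss formula along a meridian: the term `Φ_a` comes from the hyperboloid, and the coefficient
of `ν` is the principal curvature. -/
theorem pd_zero_meridianField {a : ℝ} (ha : 1 / 2 < a) (s θ : ℝ) :
    pd 0 (meridianField a) s θ =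
      catenoid a s θ + (profK a / profB a s ^ 2) • catenoidNormal a s θ := by
  have hB' := hasDerivAt_deriv_profB ha s
  have hA := (profA_pos ha s).ne'
  have hB := (profB_pos ha s).ne'
  have hφ := hasDerivAt_profPhi ha s
  have h1 : HasDerivAt (fun s => a * sinh (2 * s) / profA a s * sinh (profPhi a s)
      + profK a / (profA a s * profB a s) * cosh (profPhi a s))
      (profA a s * sinh (profPhi a s) + profK a / profB a s ^ 2 * (profK a / profA a s *
        sinh (profPhi a s)
      - a * sinh (2 * s) / (profA a s * profB a s) * cosh (profPhi a s))) s := by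
    refine (((((hasDerivAt_sinh_two_mul s).const_mul a).div (hasDerivAt_profA ha s) hA).mul
      hφ.sinh).add (((hasDerivAt_const s (profK a)).div ((hasDerivAt_profA ha s).mul
      (hasDerivAt_profB ha s)) (mul_ne_zero hA hB)).mul hφ.cosh)).congr_deriv ?_
    have hAB := profA_sq_eq_profB_sq_add_one ha s
    have hABK := profA_sq_mul_profB_sq ha s
    have hc : a * cosh (2 * s) = profB a s ^ 2 + 1 / 2 := by rw [profB_sq ha]; ring
    simp only [Pi.mul_apply, Pi.div_apply]
    clear hB'
    generalize profA a s = A at *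
    generalize profB a s = B at *
    generalize profK a = K at *
    generalize sinh (profPhi a s) = T at *
    generalize cosh (profPhi a s) = C at *
    generalize sinh (2 * s) = S at *
    generalize cosh (2 * s) = c at *
    field_simp
    grind
  refine (hasDerivAt_vecFour (hasDerivAt_fStar ha s) h1 (hB'.mul_const (cos θ))
    (hB'.mul_const (sin θ))).deriv.trans ?_
  ext i
  fin_cases i
  · simp [catenoid, catenoidNormal, height]
  · simp [catenoid, catenoidNormal]
  · simp [catenoid, catenoidNormal]; field_simp
  · simp [catenoid, catenoidNormal]; field_simp

/-- The factor `B` is the area density. The sign shows that the cross product picks the normal whose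
`x₂`-component at `(0, 0)` is `K / B > 0`. -/
theorem lorentzCross_catenoid {a : ℝ} (ha : 1 / 2 < a) (s θ : ℝ) :
    lorentzCross (catenoid a s θ) (meridianField a s θ) (parallelField a s θ) =
      profB a s • catenoidNormal a s θ := by
  have hA := (profA_pos ha s).ne'
  have hB := (profB_pos ha s).ne'
  have hAB := profA_sq_eq_profB_sq_add_one ha s
  have hC := cosh_sq (profPhi a s)
  have ht := sin_sq_add_cos_sq θ
  ext i
  fin_cases i <;>
  · simp [lorentzCross, catenoid, meridianField, parallelField, catenoidNormal, fStar,
      normalHeight, Matrix.det_succ_row_zero, Fin.sum_univ_succ, Fin.succAbove]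
    generalize profA a s = A at *
    generalize profB a s = B at *
    generalize profK a = K at *
    generalize sinh (profPhi a s) = T at *
    generalize cosh (profPhi a s) = C at *
    generalize sinh (2 * s) = S at *
    generalize cos θ = p at *
    generalize sin θ = q at *
    field_simp
    grind

theorem lorentz_catenoidNormal_self {a : ℝ} (ha : 1 / 2 < a) (s θ : ℝ) :
    lorentz (catenoidNormal a s θ) (catenoidNormal a s θ) = 1 := by
  have hA := (profA_pos ha s).ne'
  have hB := (profB_pos ha s).ne'
  have hAB := profA_sq_eq_profB_sq_add_one ha s
  have hABK := profA_sq_mul_profB_sq ha s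
  have hC := cosh_sq (profPhi a s)
  have ht := sin_sq_add_cos_sq θ
  simp only [lorentz, catenoidNormal, normalHeight]
  simp
  generalize profA a s = A at *
  generalize profB a s = B at *
  generalize profK a = K at *
  generalize sinh (profPhi a s) = T at *
  generalize cosh (profPhi a s) = C at *
  generalize sinh (2 * s) = S at *
  generalize cos θ = p at *
  generalize sin θ = q at *
  field_simp
  grind

theorem lorentz_smul_left (c : ℝ) (x y : Mink) : lorentz (c • x) y = c * lorentz x y := by
  simp [lorentz]; ring

theorem lorentz_smul_right (c : ℝ) (x y : Mink) : lorentz x (c • y) = c * lorentz x y := by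
  simp [lorentz]; ring

theorem lorentz_add_left (x y z : Mink) : lorentz (x + y) z = lorentz x z + lorentz y z := by
  simp [lorentz]; ring

theorem unitNormal_catenoid {a : ℝ} (ha : 1 / 2 < a) (s θ : ℝ) :
    unitNormal (catenoid a) s θ = catenoidNormal a s θ := by
  have hB := profB_pos ha s
  simp only [unitNormal, pd_zero_catenoid ha, pd_one_catenoid, lorentzCross_catenoid ha,
    lorentz_smul_left, lorentz_smul_right, lorentz_catenoidNormal_self ha, mul_one,
    sqrt_mul_self hB.le, inv_smul_smul₀ hB.ne']

theorem lorentz_catenoid_self {a : ℝ} (ha : 1 / 2 < a) (s θ : ℝ) :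
    lorentz (catenoid a s θ) (catenoid a s θ) = -1 := by
  have hAB := profA_sq_eq_profB_sq_add_one ha s
  have hC := cosh_sq (profPhi a s)
  have ht := sin_sq_add_cos_sq θ
  simp [lorentz, catenoid]
  grind

theorem lorentz_catenoid_normal {a : ℝ} (ha : 1 / 2 < a) (s θ : ℝ) :
    lorentz (catenoid a s θ) (catenoidNormal a s θ) = 0 := by
  have hA := (profA_pos ha s).ne'
  have hB := (profB_pos ha s).ne'
  have hC := cosh_sq (profPhi a s)
  have ht := sin_sq_add_cos_sq θ
  simp [lorentz, catenoid, catenoidNormal, normalHeight]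
  field_simp
  grind

theorem firstForm_catenoid {a : ℝ} (ha : 1 / 2 < a) (s θ : ℝ) :
    firstForm (catenoid a) s θ = !![1, 0; 0, profB a s ^ 2] := by
  have hA := (profA_pos ha s).ne'
  have hB := (profB_pos ha s).ne'
  have hAB := profA_sq_eq_profB_sq_add_one ha s
  have hABK := profA_sq_mul_profB_sq ha s
  have hC := cosh_sq (profPhi a s)
  have ht := sin_sq_add_cos_sq θ
  ext i j
  fin_cases i <;> fin_cases j <;>
    simp [firstForm, pd_zero_catenoid ha, pd_one_catenoid, lorentz, meridianField, parallelField,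
      fStar]
  · generalize profA a s = A at *
    generalize profB a s = B at *
    generalize profK a = K at *
    generalize sinh (profPhi a s) = T at *
    generalize cosh (profPhi a s) = C at *
    generalize sinh (2 * s) = S at *
    generalize cos θ = p at *
    generalize sin θ = q at *
    field_simp
    grind
  · ring
  · ring
  · grind

theorem secondForm_catenoid {a : ℝ} (ha : 1 / 2 < a) (s θ : ℝ) :
    secondForm (catenoid a) s θ = !![profK a / profB a s ^ 2, 0; 0, -profK a] := by
  have hB := (profB_pos ha s).ne'
  have ht := sin_sq_add_cos_sq θ
  ext i j
  fin_cases i <;> fin_cases j <;>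
    simp only [secondForm, unitNormal_catenoid ha, Fin.zero_eta, Fin.mk_one, Fin.isValue,
      Matrix.of_apply, pd_zero_catenoid ha, pd_one_catenoid, pd_zero_meridianField ha,
      pd_one_meridianField, pd_zero_parallelField ha, pd_one_parallelField, lorentz_add_left,
      lorentz_smul_left, lorentz_catenoidNormal_self ha, lorentz_catenoid_normal ha]
  · simp
  · simp [lorentz, catenoidNormal]; ring
  · simp [lorentz, catenoidNormal]; ring
  · simp [lorentz, catenoidNormal]
    field_simp
    grind

theorem inv_firstForm_catenoid {a : ℝ} (ha : 1 / 2 < a) (s θ : ℝ) :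
    (firstForm (catenoid a) s θ)⁻¹ = !![1, 0; 0, (profB a s ^ 2)⁻¹] := by
  have hB := (profB_pos ha s).ne'
  rw [firstForm_catenoid ha]
  refine Matrix.inv_eq_right_inv ?_
  ext i j
  fin_cases i <;> fin_cases j <;> simp [Matrix.mul_apply, Fin.sum_univ_succ, hB]

theorem shapeOperator_catenoid {a : ℝ} (ha : 1 / 2 < a) (s θ : ℝ) :
    shapeOperator (catenoid a) s θ =
      !![profK a / profB a s ^ 2, 0; 0, -(profK a / profB a s ^ 2)] := by
  have hB := (profB_pos ha s).ne'
  rw [shapeOperator, inv_firstForm_catenoid ha, secondForm_catenoid ha]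
  ext i j
  fin_cases i <;> fin_cases j <;> simp [Matrix.mul_apply, Fin.sum_univ_succ]
  ring

theorem meanCurvature_catenoid {a : ℝ} (ha : 1 / 2 < a) (s θ : ℝ) :
    meanCurvature (catenoid a) s θ = 0 := by
  simp [meanCurvature, shapeOperator_catenoid ha, Matrix.trace, Fin.sum_univ_succ]

theorem secondFormNormSq_catenoid {a : ℝ} (ha : 1 / 2 < a) (s θ : ℝ) :
    secondFormNormSq (catenoid a) s θ = 2 * profK a ^ 2 / profB a s ^ 4 := by
  have hB := (profB_pos ha s).ne'
  simp [secondFormNormSq, shapeOperator_catenoid ha, Matrix.trace, Fin.sum_univ_succ]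
  field_simp
  ring

/-! ### Normal components of the rotation fields. -/

theorem killingJacobi_one_two {a : ℝ} (ha : 1 / 2 < a) (s θ : ℝ) :
    killingJacobi a 1 2 s θ = fStar a s * cos θ := by
  have hA := (profA_pos ha s).ne'
  have hB := (profB_pos ha s).ne'
  have hAB := profA_sq_eq_profB_sq_add_one ha s
  rw [killingJacobi, unitNormal_catenoid ha]
  simp [rotationField, catenoid, catenoidNormal, lorentz, fStar]
  field_simp
  grind

theorem killingJacobi_one_three {a : ℝ} (ha : 1 / 2 < a) (s θ : ℝ) :
    killingJacobi a 1 3 s θ = fStar a s * sin θ := by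
  have hA := (profA_pos ha s).ne'
  have hB := (profB_pos ha s).ne'
  have hAB := profA_sq_eq_profB_sq_add_one ha s
  rw [killingJacobi, unitNormal_catenoid ha]
  simp [rotationField, catenoid, catenoidNormal, lorentz, fStar]
  field_simp
  grind

/-! ### The free boundary condition -/

theorem one_lt_height {a : ℝ} (ha : 1 / 2 < a) (s : ℝ) : 1 < height a s := by
  have hA : 1 < profA a s := by
    rw [profA]; exact (Real.lt_sqrt zero_le_one).2 (by simpa using one_lt_profA_sq ha s)
  exact one_lt_mul_of_lt_of_le hA (one_le_cosh _)

theorem strictMonoOn_height {a : ℝ} (ha : 1 / 2 < a) : StrictMonoOn (height a) (Ici 0) := by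
  refine strictMonoOn_of_deriv_pos (convex_Ici 0)
    (fun s _ => (hasDerivAt_height ha s).continuousAt.continuousWithinAt) fun s hs => ?_
  rw [interior_Ici] at hs
  rw [(hasDerivAt_height ha s).deriv]
  exact fStar_pos ha hs

theorem strictAntiOn_normalHeight {a : ℝ} (ha : 1 / 2 < a) :
    StrictAntiOn (normalHeight a) (Ici 0) := by
  refine strictAntiOn_of_deriv_neg (convex_Ici 0)
    (fun s _ => (hasDerivAt_normalHeight ha s).continuousAt.continuousWithinAt) fun s hs => ?_
  rw [interior_Ici] at hs
  rw [(hasDerivAt_normalHeight ha s).deriv]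
  have := fStar_pos ha hs
  have := profK_pos ha
  have := profB_pos ha s
  rw [neg_mul, neg_lt_zero]
  positivity

theorem normalHeight_zero_pos {a : ℝ} (ha : 1 / 2 < a) : 0 < normalHeight a 0 := by
  have := div_pos (profK_pos ha) (profA_pos ha 0)
  simpa [normalHeight, profPhi_zero] using this

/-- Negativity means `tanh φ > K B / (a sinh 2s)`. The right side tends to `0`, while `tanh φ` stays
above its value at `s = 1`; an explicit `s` is produced instead of a limit. -/
theorem exists_normalHeight_neg {a : ℝ} (ha : 1 / 2 < a) : ∃ s, 0 < s ∧ normalHeight a s < 0 := by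
  have hK := profK_pos ha
  have ha0 : 0 < a := by linarith
  have hT₁ := sinh_pos_iff.2 (profPhi_pos ha zero_lt_one)
  have hC₁ := cosh_pos (profPhi a 1)
  set t := sinh (profPhi a 1) / cosh (profPhi a 1) with ht
  have ht0 : 0 < t := div_pos hT₁ hC₁
  -- Chosen so that, after squaring, `K B < a t sinh 2s` follows from `X ≤ cosh 2s - 1`. The point
  -- `X + 1` satisfies this and is at least `1`, so `tanh φ ≥ t` there.
  set X := profK a ^ 2 / (a * t ^ 2) with hX
  have hX0 : 0 < X := by positivity
  have hXe : X * (a * t ^ 2) = profK a ^ 2 := by rw [hX]; field_simp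
  refine ⟨X + 1, by linarith, ?_⟩
  have hA := profA_pos ha (X + 1)
  have hB := profB_pos ha (X + 1)
  have hC := cosh_pos (profPhi a (X + 1))
  have hS : 0 < sinh (2 * (X + 1)) := sinh_pos_iff.2 (by linarith)
  have hT : t * cosh (profPhi a (X + 1)) ≤ sinh (profPhi a (X + 1)) := by
    have h := sinh_nonneg_iff.2 (sub_nonneg.2 ((strictMono_profPhi ha).monotone
      (show 1 ≤ X + 1 by linarith)))
    -- `sinh (φ(X + 1) - φ(1)) ≥ 0` is monotonicity of `tanh` with denominators cleared.
    rw [sinh_sub] at h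
    rw [ht, div_mul_eq_mul_div, div_le_iff₀ hC₁]
    linarith
  have hc : X + 1 ≤ cosh (2 * (X + 1)) := by
    have h1 := add_one_le_exp (2 * (X + 1))
    have h2 := exp_pos (-(2 * (X + 1)))
    rw [cosh_eq]
    linarith
  have hKB : profK a * profB a (X + 1) < a * sinh (2 * (X + 1)) * t := by
    refine lt_of_pow_lt_pow_left₀ 2 (by positivity) ?_
    have hs := cosh_sq (2 * (X + 1))
    rw [mul_pow, profB_sq ha, ← hXe]
    have : (a * sinh (2 * (X + 1)) * t) ^ 2 =
        a ^ 2 * t ^ 2 * ((cosh (2 * (X + 1)) - 1) * (cosh (2 * (X + 1)) + 1)) := by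
      linear_combination -a ^ 2 * t ^ 2 * hs
    rw [this]
    have h1 : X * (cosh (2 * (X + 1)) + 1) ≤
        (cosh (2 * (X + 1)) - 1) * (cosh (2 * (X + 1)) + 1) :=
      mul_le_mul_of_nonneg_right (by linarith) (by linarith)
    have h2 := mul_le_mul_of_nonneg_left h1 (show 0 ≤ a ^ 2 * t ^ 2 by positivity)
    have h3 : 0 < X * (a * t ^ 2) * (a + 1 / 2) := by positivity
    linarith
  have key : profK a * profB a (X + 1) * cosh (profPhi a (X + 1)) <
      a * sinh (2 * (X + 1)) * sinh (profPhi a (X + 1)) :=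
    calc _ < a * sinh (2 * (X + 1)) * t * cosh (profPhi a (X + 1)) := by gcongr
      _ = a * sinh (2 * (X + 1)) * (t * cosh (profPhi a (X + 1))) := by ring
      _ ≤ _ := by gcongr
  have : normalHeight a (X + 1) = (profK a * profB a (X + 1) * cosh (profPhi a (X + 1))
      - a * sinh (2 * (X + 1)) * sinh (profPhi a (X + 1)))
      / (profA a (X + 1) * profB a (X + 1)) := by
    rw [normalHeight]; field_simp
  rw [this]
  exact div_neg_of_neg_of_pos (by linarith) (by positivity)

theorem existsUnique_normalHeight_eq_zero {a : ℝ} (ha : 1 / 2 < a) :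
    ∃! s, 0 < s ∧ normalHeight a s = 0 := by
  obtain ⟨b, hb, hneg⟩ := exists_normalHeight_neg ha
  have hcont : ContinuousOn (normalHeight a) (Icc 0 b) := fun s _ =>
    (hasDerivAt_normalHeight ha s).continuousAt.continuousWithinAt
  obtain ⟨s, hs, h0⟩ := intermediate_value_Icc' hb.le hcont
    ⟨hneg.le, (normalHeight_zero_pos ha).le⟩
  refine ⟨s, ⟨hs.1.lt_of_ne fun h => ?_, h0⟩, fun t ht =>
    (strictAntiOn_normalHeight ha).injOn ht.1.le hs.1 (ht.2.trans h0.symm)⟩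
  exact (normalHeight_zero_pos ha).ne' (h ▸ h0)

theorem catenoid_mem_hyperbolicSpace {a : ℝ} (ha : 1 / 2 < a) (s θ : ℝ) :
    catenoid a s θ ∈ hyperbolicSpace :=
  ⟨lorentz_catenoid_self ha s θ, mul_pos (profA_pos ha s) (cosh_pos _)⟩

theorem hypDist_origin_catenoid (a s θ : ℝ) :
    hypDist origin (catenoid a s θ) = arcosh (height a s) := by
  simp [hypDist, lorentz, origin, catenoid, height]

theorem bdryRadius_eq (a s : ℝ) : bdryRadius a s = arcosh (height a s) := rfl

theorem bdryRadius_pos {a : ℝ} (ha : 1 / 2 < a) (s : ℝ) : 0 < bdryRadius a s :=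
  arcosh_pos (one_lt_height ha s)

/-- The radial part of the sphere normal is a multiple of `Φ_a`, hence orthogonal to `ν`; only
`⟨-∂₀, ν⟩_L = ν₀` survives. -/
theorem lorentz_unitNormal_sphereNormal {a : ℝ} (ha : 1 / 2 < a) (r s θ : ℝ) :
    lorentz (unitNormal (catenoid a) s θ) (sphereNormal r (catenoid a s θ)) =
      (sinh r)⁻¹ * normalHeight a s := by
  have h := lorentz_catenoid_normal ha s θ
  rw [unitNormal_catenoid ha, sphereNormal, lorentz_smul_right]
  congr 1
  have h0 : catenoidNormal a s θ 0 = normalHeight a s := rfl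
  simp only [lorentz, origin, Pi.add_apply, Pi.neg_apply, Pi.smul_apply, smul_eq_mul,
    Pi.single_eq_same] at h ⊢
  simp [h0] at h ⊢
  linear_combination catenoid a s θ 0 * h

theorem height_abs (a s : ℝ) : height a |s| = height a s := by
  rcases abs_choice s with h | h <;> simp [h, height_neg]

theorem contDiff_catenoid {a : ℝ} (ha : 1 / 2 < a) :
    ContDiff ℝ ∞ (fun p : ℝ × ℝ => catenoid a p.1 p.2) := by
  have hA := (contDiff_profA ha).comp (contDiff_fst (𝕜 := ℝ) (E := ℝ) (F := ℝ))
  have hB := (contDiff_profB ha).comp (contDiff_fst (𝕜 := ℝ) (E := ℝ) (F := ℝ))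
  have hφ := (contDiff_profPhi ha).comp (contDiff_fst (𝕜 := ℝ) (E := ℝ) (F := ℝ))
  rw [contDiff_pi]
  intro i
  fin_cases i
  · exact hA.mul hφ.cosh
  · exact hA.mul hφ.sinh
  · exact hB.mul contDiff_snd.cos
  · exact hB.mul contDiff_snd.sin

/-- Orthogonality is the only requirement that constrains `s₀`. -/
theorem isCritical_iff {a : ℝ} (ha : 1 / 2 < a) (s₀ : ℝ) :
    IsCritical a s₀ ↔ 0 < s₀ ∧ normalHeight a s₀ = 0 := by
  refine and_congr_right fun hs₀ => ⟨fun h => ?_, fun h => ?_⟩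
  · have h1 := h.orthogonal s₀ (by simp) 0
    rw [lorentz_unitNormal_sphereNormal ha] at h1
    exact (mul_eq_zero.1 h1).resolve_left
      (inv_ne_zero (sinh_pos_iff.2 (bdryRadius_pos ha s₀)).ne')
  · refine ⟨contDiff_catenoid ha, fun s _ θ => ?_, fun s _ θ => meanCurvature_catenoid ha s θ,
      fun s hs θ => ⟨catenoid_mem_hyperbolicSpace ha s θ, ?_⟩,
      fun s hs θ => ⟨catenoid_mem_hyperbolicSpace ha s θ, ?_⟩, fun s hs θ => ?_⟩
    · simpa [firstForm_catenoid ha, Matrix.det_fin_two] using pow_pos (profB_pos ha s) 2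
    · have h1 := one_lt_height ha s
      have h2 := one_lt_height ha s₀
      rw [hypDist_origin_catenoid, bdryRadius_eq, arcosh_lt_arcosh (by linarith) (by linarith),
        ← height_abs]
      exact strictMonoOn_height ha (abs_nonneg s) hs₀.le (abs_lt.2 hs)
    · rw [hypDist_origin_catenoid, bdryRadius_eq]
      rcases hs with rfl | rfl
      · rw [height_neg]
      · rfl
    · rw [lorentz_unitNormal_sphereNormal ha]
      rcases hs with rfl | rfl
      · rw [normalHeight_neg, h, mul_zero]
      · rw [h, mul_zero]

theorem coth_bdryRadius {a s₀ : ℝ} (ha : 1 / 2 < a) (hs₀ : 0 < s₀) (h : normalHeight a s₀ = 0) :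
    cosh (bdryRadius a s₀) / sinh (bdryRadius a s₀) = height a s₀ / fStar a s₀ := by
  have h1 := (one_lt_height ha s₀).le
  rw [bdryRadius_eq, cosh_arcosh h1, sinh_arcosh h1]
  congr 1
  rw [height_sq ha, h]
  convert sqrt_sq (fStar_pos ha hs₀).le using 2
  ring

/-! ### The Jacobi operator in angular mode one -/

/-- The derivative of `f_*`. -/
noncomputable def fStarDeriv (a s : ℝ) : ℝ :=
  height a s + profK a / profB a s ^ 2 * normalHeight a s

/-- The Jacobi operator in angular mode one, applied to a function of `s` with value `y`, first
derivative `y₁` and second derivative `y₂` at `s`. -/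
noncomputable def modeOneJacobi (a s y y₁ y₂ : ℝ) : ℝ :=
  y₂ + a * sinh (2 * s) / profB a s ^ 2 * y₁ +
    (2 * profK a ^ 2 / profB a s ^ 4 - 2 - 1 / profB a s ^ 2) * y

/-- Rotations preserve minimality, so `f_*` must be a Jacobi solution; the proof checks this by
substitution. Only the equation for the second derivative is needed later, hence the existential. -/
theorem hasDerivAt_fStarDeriv {a : ℝ} (ha : 1 / 2 < a) (s : ℝ) :
    ∃ y₂, HasDerivAt (fStarDeriv a) y₂ s ∧
      modeOneJacobi a s (fStar a s) (fStarDeriv a s) y₂ = 0 := by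
  have hA := (profA_pos ha s).ne'
  have hB := (profB_pos ha s).ne'
  refine ⟨_, (hasDerivAt_height ha s).add (((hasDerivAt_const s (profK a)).div
    ((hasDerivAt_profB ha s).pow 2) (pow_ne_zero 2 hB)).mul (hasDerivAt_normalHeight ha s)), ?_⟩
  have hAB := profA_sq_eq_profB_sq_add_one ha s
  have hABK := profA_sq_mul_profB_sq ha s
  simp only [modeOneJacobi, fStar, fStarDeriv, height, normalHeight, Pi.div_apply, Pi.pow_apply]
  generalize profA a s = A at *
  generalize profB a s = B at *
  generalize profK a = K at *
  generalize sinh (profPhi a s) = T at *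
  generalize cosh (profPhi a s) = C at *
  generalize sinh (2 * s) = S at *
  field_simp
  grind

theorem continuous_fStarDeriv {a : ℝ} (ha : 1 / 2 < a) : Continuous (fStarDeriv a) :=
  continuous_iff_continuousAt.2 fun s =>
    let ⟨_, h, _⟩ := hasDerivAt_fStarDeriv ha s
    h.continuousAt

theorem continuous_fStar {a : ℝ} (ha : 1 / 2 < a) : Continuous (fStar a) :=
  continuous_iff_continuousAt.2 fun s => (hasDerivAt_fStar ha s).continuousAt

theorem fStarDeriv_neg (a s : ℝ) : fStarDeriv a (-s) = fStarDeriv a s := by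
  simp only [fStarDeriv, height_neg, normalHeight_neg, profB_neg]

theorem fStarDeriv_zero_pos {a : ℝ} (ha : 1 / 2 < a) : 0 < fStarDeriv a 0 := by
  have := one_lt_height ha 0
  have := normalHeight_zero_pos ha
  have := profK_pos ha
  have := profB_pos ha 0
  unfold fStarDeriv
  positivity

/-- Smoothness is inherited from `height`, whose derivative is `f_*`. -/
theorem contDiff_fStar {a : ℝ} (ha : 1 / 2 < a) : ContDiff ℝ ∞ (fStar a) := by
  have h : height a = fun s => profA a s * cosh (profPhi a s) := rfl
  have h2 := ((contDiff_profA ha).mul (contDiff_profPhi ha).cosh)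
  rw [← h, contDiff_infty_iff_deriv] at h2
  rw [← show deriv (height a) = fStar a from funext fun s => (hasDerivAt_height ha s).deriv]
  exact h2.2

theorem sqrt_det_firstForm {a : ℝ} (ha : 1 / 2 < a) (s θ : ℝ) :
    √(firstForm (catenoid a) s θ).det = profB a s := by
  simp [firstForm_catenoid ha, Matrix.det_fin_two, sqrt_sq (profB_pos ha s).le]

/-- Separation of variables for `ds² + B² dθ²`: the first order term is `B' / B`, and `∂_θ²`
contributes `-1 / B²`. Derivatives are required only near `s`, because `inCoords` is cut off to zero
outside the annulus. -/
theorem jacobiOperator_modeOne {a : ℝ} (ha : 1 / 2 < a) {u : ℝ → ℝ → ℝ} {f f₁ g g₁ : ℝ → ℝ}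
    {f₂ g₂ s : ℝ} (hu : ∀ t θ, u t θ = f t * cos θ + g t * sin θ)
    (hf : ∀ᶠ t in nhds s, HasDerivAt f (f₁ t) t) (hg : ∀ᶠ t in nhds s, HasDerivAt g (g₁ t) t)
    (hf₁ : HasDerivAt f₁ f₂ s) (hg₁ : HasDerivAt g₁ g₂ s) (θ : ℝ) :
    jacobiOperator (catenoid a) u s θ =
      modeOneJacobi a s (f s) (f₁ s) f₂ * cos θ + modeOneJacobi a s (g s) (g₁ s) g₂ * sin θ := by
  have hB := (profB_pos ha s).ne'
  obtain rfl : u = fun t θ => f t * cos θ + g t * sin θ := funext₂ hu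
  have hpd1 : ∀ θ, pd 1 (fun t θ => f t * cos θ + g t * sin θ) s θ =
      f s * -sin θ + g s * cos θ := fun θ =>
    (((hasDerivAt_cos θ).const_mul (f s)).add ((hasDerivAt_sin θ).const_mul (g s))).deriv
  have hpd0 : ∀ᶠ t in nhds s, pd 0 (fun t θ => f t * cos θ + g t * sin θ) t θ =
      f₁ t * cos θ + g₁ t * sin θ := by
    filter_upwards [hf, hg] with t h1 h2
    exact ((h1.mul_const (cos θ)).add (h2.mul_const (sin θ))).deriv
  have h0 : pd 0 (fun s' θ' => profB a s' *
      pd 0 (fun t θ => f t * cos θ + g t * sin θ) s' θ') s θ =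
      a * sinh (2 * s) / profB a s * (f₁ s * cos θ + g₁ s * sin θ)
        + profB a s * (f₂ * cos θ + g₂ * sin θ) := by
    refine Filter.EventuallyEq.deriv_eq (hpd0.mono fun t ht => ?_) |>.trans
      ((hasDerivAt_profB ha s).mul ((hf₁.mul_const (cos θ)).add (hg₁.mul_const (sin θ)))).deriv
    simp only [ht, Pi.mul_apply, Pi.add_apply]
  have h1 : pd 1 (fun s' θ' => profB a s' * ((profB a s' ^ 2)⁻¹ *
      pd 1 (fun t θ => f t * cos θ + g t * sin θ) s' θ')) s θ =
      profB a s * ((profB a s ^ 2)⁻¹ * (f s * -cos θ + g s * -sin θ)) := by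
    refine Eq.trans ?_ (((((hasDerivAt_sin θ).neg.const_mul (f s)).add
      ((hasDerivAt_cos θ).const_mul (g s))).const_mul ((profB a s ^ 2)⁻¹)).const_mul
        (profB a s)).deriv
    simp only [pd, one_ne_zero, if_false]
    congr 1
    funext t
    have := hpd1 t
    simp only [pd, one_ne_zero, if_false] at this
    rw [this]
    simp
  simp only [jacobiOperator, laplaceBeltrami, sqrt_det_firstForm ha, inv_firstForm_catenoid ha,
    secondFormNormSq_catenoid ha, Fin.sum_univ_two, modeOneJacobi]
  simp only [Matrix.of_apply, Matrix.cons_val', Matrix.cons_val_zero, Matrix.cons_val_one,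
    Matrix.cons_val_fin_one, one_mul, zero_mul, add_zero, zero_add, h0, h1]
  field_simp
  ring

theorem conormalDeriv_catenoid {a : ℝ} (ha : 1 / 2 < a) (s₀ ε : ℝ) (u : ℝ → ℝ → ℝ) (θ : ℝ) :
    conormalDeriv (catenoid a) s₀ ε u θ =
      ε * derivWithin (fun t => u t θ) (Icc (-s₀) s₀) (ε * s₀) := by
  simp [conormalDeriv, inv_firstForm_catenoid ha]

/-! ### The mode one Robin problem -/

theorem eq_of_hasDerivAt_zero {W : ℝ → ℝ} {b c : ℝ} (hW : ContinuousOn W (Icc b c))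
    (hW' : ∀ s ∈ Ioo b c, HasDerivAt W 0 s) {s : ℝ} (hs : s ∈ Icc b c) : W s = W c := by
  have hd : DifferentiableOn ℝ W (interior (Icc b c)) := fun t ht =>
    (hW' t (by simpa using ht)).differentiableAt.differentiableWithinAt
  have hz : ∀ t ∈ interior (Icc b c), deriv W t = 0 := fun t ht =>
    (hW' t (by simpa using ht)).deriv
  have hc : c ∈ Icc b c := right_mem_Icc.2 (hs.1.trans hs.2)
  exact le_antisymm
    (monotoneOn_of_deriv_nonneg (convex_Icc b c) hW hd (fun t ht => (hz t ht).ge) hs hc hs.2)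
    (antitoneOn_of_deriv_nonpos (convex_Icc b c) hW hd (fun t ht => (hz t ht).le) hs hc hs.2)

/-- Vanishing Wronskian makes `F / f_*` constant where `f_* > 0`. At `s = 0` the quotient is
undefined, so the constant is expressed by derivatives there; this form lets the two halves of the
interval be glued. -/
theorem eq_mul_fStar_of_wronskian_eq_zero {a : ℝ} (ha : 1 / 2 < a) {b : ℝ} (hb : 0 < b)
    {F F₁ : ℝ → ℝ} (hF : ContinuousOn F (Icc 0 b)) (hF₁ : ContinuousOn F₁ (Icc 0 b))
    (hF' : ∀ s ∈ Ioo 0 b, HasDerivAt F (F₁ s) s)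
    (hW : ∀ s ∈ Icc 0 b, F s * fStarDeriv a s = F₁ s * fStar a s) :
    ∀ s ∈ Icc 0 b, F s = F₁ 0 / fStarDeriv a 0 * fStar a s := by
  set d := F b / fStar a b with hd
  have hIoc : ∀ s ∈ Ioc 0 b, F s = d * fStar a s := by
    intro s hs
    have hY : ∀ t ∈ Icc s b, fStar a t ≠ 0 := fun t ht => (fStar_pos ha (hs.1.trans_le ht.1)).ne'
    have hsub : Icc s b ⊆ Icc 0 b := Icc_subset_Icc_left hs.1.le
    have h := eq_of_hasDerivAt_zero (W := fun t => F t / fStar a t) (b := s) (c := b)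
      ((hF.mono hsub).div (continuous_fStar ha).continuousOn hY) (fun t ht => by
        refine ((hF' t ⟨hs.1.trans ht.1, ht.2⟩).div (hasDerivAt_fStar ha t)
          (hY t (Ioo_subset_Icc_self ht))).congr_deriv ?_
        have := hW t (hsub (Ioo_subset_Icc_self ht))
        rw [fStarDeriv] at this
        rw [this, sub_self, zero_div]) (left_mem_Icc.2 hs.2)
    rw [hd, ← h]
    exact (div_mul_cancel₀ _ (hY s (left_mem_Icc.2 hs.2))).symm
  have hIoc₁ : ∀ s ∈ Ioc 0 b, F₁ s = d * fStarDeriv a s := by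
    intro s hs
    refine mul_right_cancel₀ (fStar_pos ha hs.1).ne' ?_
    rw [← hW s (Ioc_subset_Icc_self hs), hIoc s hs]
    ring
  have hcl : Icc 0 b ⊆ closure (Ioc 0 b) := (closure_Ioc hb.ne).ge
  -- Letting `s → 0` in `F₁ = d f_*'` identifies `d`, since `f_*'(0) > 0`.
  have h0 : F₁ 0 = d * fStarDeriv a 0 := EqOn.of_subset_closure hIoc₁ hF₁
    (continuous_const.mul (continuous_fStarDeriv ha)).continuousOn Ioc_subset_Icc_self hcl
    (left_mem_Icc.2 hb.le)
  rw [h0, mul_div_cancel_right₀ _ (fStarDeriv_zero_pos ha).ne']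
  exact EqOn.of_subset_closure hIoc hF
    (continuous_const.mul (continuous_fStar ha)).continuousOn Ioc_subset_Icc_self hcl

theorem eq_mul_fStar_of_modeOneJacobi_eq_zero {a : ℝ} (ha : 1 / 2 < a) {b : ℝ} (hb : 0 < b)
    {F F₁ F₂ : ℝ → ℝ} (hF : ContinuousOn F (Icc (-b) b)) (hF₁ : ContinuousOn F₁ (Icc (-b) b))
    (hF' : ∀ s ∈ Ioo (-b) b, HasDerivAt F (F₁ s) s)
    (hF₁' : ∀ s ∈ Ioo (-b) b, HasDerivAt F₁ (F₂ s) s)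
    (hode : ∀ s ∈ Ioo (-b) b, modeOneJacobi a s (F s) (F₁ s) (F₂ s) = 0)
    (hbdry : F b * fStarDeriv a b = F₁ b * fStar a b) :
    ∃ c, ∀ s ∈ Icc (-b) b, F s = c * fStar a s := by
  -- Abel's formula: the weight `B` absorbs the first order term `B' / B`, so the weighted Wronskian
  -- is constant, and `hbdry` makes it zero.
  have hW : ∀ s ∈ Icc (-b) b, F s * fStarDeriv a s = F₁ s * fStar a s := by
    intro s hs
    have hB := profB_pos ha s
    have h := eq_of_hasDerivAt_zero
      (W := fun t => profB a t * (F t * fStarDeriv a t - F₁ t * fStar a t))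
      ((contDiff_profB ha).continuous.continuousOn.mul
        ((hF.mul (continuous_fStarDeriv ha).continuousOn).sub
          (hF₁.mul (continuous_fStar ha).continuousOn))) (fun t ht => by
        obtain ⟨y₂, hy₂, hy⟩ := hasDerivAt_fStarDeriv ha t
        have hB := (profB_pos ha t).ne'
        refine ((hasDerivAt_profB ha t).mul (((hF' t ht).mul hy₂).sub
          ((hF₁' t ht).mul (hasDerivAt_fStar ha t)))).congr_deriv ?_
        have hx := hode t ht
        rw [modeOneJacobi] at hx hy
        rw [← fStarDeriv]
        simp only [Pi.mul_apply, Pi.sub_apply]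
        have e : a * sinh (2 * t) / profB a t =
          profB a t * (a * sinh (2 * t) / profB a t ^ 2) := by field_simp
        rw [e]
        linear_combination profB a t * F t * hy - profB a t * fStar a t * hx) hs
    simp only [hbdry, sub_self, mul_zero] at h
    exact sub_eq_zero.1 ((mul_eq_zero.1 h).resolve_left hB.ne')
  have hsub : Icc 0 b ⊆ Icc (-b) b := Icc_subset_Icc_left (by linarith)
  have hmaps : MapsTo (fun s : ℝ => -s) (Icc 0 b) (Icc (-b) b) := fun s hs =>
    ⟨neg_le_neg hs.2, by linarith [hs.1]⟩
  refine ⟨F₁ 0 / fStarDeriv a 0, fun s hs => ?_⟩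
  rcases le_total 0 s with h0 | h0
  · exact eq_mul_fStar_of_wronskian_eq_zero ha hb (hF.mono hsub) (hF₁.mono hsub)
      (fun t ht => hF' t ⟨by linarith [ht.1], ht.2⟩) (fun t ht => hW t (hsub ht)) s ⟨h0, hs.2⟩
  -- The odd reflection of `F` has the same derivative at `0` as `F`, so the left half yields the
  -- same constant.
  · have h := eq_mul_fStar_of_wronskian_eq_zero ha hb (F := fun t => -F (-t))
      (F₁ := fun t => F₁ (-t)) (hF.comp continuous_neg.continuousOn hmaps).neg
      (hF₁.comp continuous_neg.continuousOn hmaps) (fun t ht => by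
        refine ((hF' (-t) ⟨neg_lt_neg ht.2, by linarith [ht.1, ht.2]⟩).scomp t
          (hasDerivAt_neg t)).neg.congr_deriv ?_
        simp) (fun t ht => by
        have := hW (-t) (hmaps ht)
        rw [fStarDeriv_neg, fStar_neg] at this
        linarith) (-s) ⟨by linarith, by linarith [hs.1]⟩
    simp only [neg_neg, neg_zero, fStar_neg] at h
    linarith

/-! ### From functions on the annulus to functions of `s`. -/

theorem inCoords_of_mem {s₀ s : ℝ} (u : Annulus s₀ → ℝ) (hs : s ∈ Icc (-s₀) s₀) (θ : ℝ) :
    inCoords u s θ = u (⟨s, hs⟩, (θ : Real.Angle)) := dif_pos hs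

/-- The coefficients in `IsModeOne` carry no regularity; writing them as the slices `θ = 0` and `θ =
π / 2` lets them inherit that of `u`. -/
theorem IsModeOne.inCoords_eq {s₀ : ℝ} {u : Annulus s₀ → ℝ} (hu : IsModeOne u) (s θ : ℝ) :
    inCoords u s θ = inCoords u s 0 * cos θ + inCoords u s (π / 2) * sin θ := by
  obtain ⟨f, g, h⟩ := hu
  by_cases hs : s ∈ Icc (-s₀) s₀
  · simp [inCoords_of_mem u hs, h, -Real.Angle.coe_zero, Real.Angle.cos_coe, Real.Angle.sin_coe]
  · simp [inCoords, hs]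

/-- Where `ν₀ = 0`, `f_*' = x₀ = cosh r` and `f_* = sinh r`. -/
theorem robin_fStar {a s₀ : ℝ} (ha : 1 / 2 < a) (hs₀ : 0 < s₀) (h : normalHeight a s₀ = 0) :
    fStarDeriv a s₀ = cosh (bdryRadius a s₀) / sinh (bdryRadius a s₀) * fStar a s₀ := by
  rw [coth_bdryRadius ha hs₀ h, div_mul_cancel₀ _ (fStar_pos ha hs₀).ne', fStarDeriv, h, mul_zero,
    add_zero]

/-- The mode one function `(c cos θ + d sin θ) f_*(s)` on the annulus. -/
noncomputable def modeOneFStar (a s₀ c d : ℝ) : Annulus s₀ → ℝ :=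
  fun p => c * fStar a p.1 * p.2.cos + d * fStar a p.1 * p.2.sin

theorem inCoords_modeOneFStar {s₀ s : ℝ} (a c d : ℝ) (hs : s ∈ Icc (-s₀) s₀) (θ : ℝ) :
    inCoords (modeOneFStar a s₀ c d) s θ = c * fStar a s * cos θ + d * fStar a s * sin θ := by
  simp [inCoords_of_mem _ hs, modeOneFStar]

theorem isModeOne_modeOneFStar (a s₀ c d : ℝ) : IsModeOne (modeOneFStar a s₀ c d) :=
  ⟨fun s => c * fStar a s, fun s => d * fStar a s, fun _ => rfl⟩

theorem modeOneFStar_mem_robinEigenspace {a s₀ : ℝ} (ha : 1 / 2 < a) (hs₀ : 0 < s₀)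
    (h : normalHeight a s₀ = 0) (c d : ℝ) (n : ℕ∞) :
    modeOneFStar a s₀ c d ∈ robinEigenspace a s₀ 0 n := by
  refine ⟨?_, isModeOne_modeOneFStar a s₀ c d, fun s hs θ => ?_, fun ε hε θ => ?_⟩
  · have hf := (contDiff_fStar ha).comp (contDiff_fst (𝕜 := ℝ) (E := ℝ) (F := ℝ))
    have : ContDiff ℝ ∞ (fun p : ℝ × ℝ =>
        c * fStar a p.1 * cos p.2 + d * fStar a p.1 * sin p.2) :=
      ((contDiff_const.mul hf).mul contDiff_snd.cos).add
        ((contDiff_const.mul hf).mul contDiff_snd.sin)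
    exact (this.of_le (mod_cast le_top)).contDiffOn.congr fun p hp =>
      inCoords_modeOneFStar a c d hp.1 p.2
  · obtain ⟨y₂, hy₂, hy⟩ := hasDerivAt_fStarDeriv ha s
    have hs' := Ioo_subset_Icc_self hs
    have hev : ∀ θ' e, (∀ t ∈ Icc (-s₀) s₀,
        inCoords (modeOneFStar a s₀ c d) t θ' = e * fStar a t) →
        ∀ᶠ t in nhds s, HasDerivAt (fun t => inCoords (modeOneFStar a s₀ c d) t θ')
          (e * fStarDeriv a t) t := by
      intro θ' e he
      filter_upwards [isOpen_Ioo.mem_nhds hs] with t ht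
      refine ((hasDerivAt_fStar ha t).const_mul e).congr_of_eventuallyEq ?_
      filter_upwards [isOpen_Ioo.mem_nhds ht] with x hx
      exact he x (Ioo_subset_Icc_self hx)
    have h0 : ∀ t ∈ Icc (-s₀) s₀, inCoords (modeOneFStar a s₀ c d) t 0 = c * fStar a t :=
      fun t ht => by simp [inCoords_modeOneFStar a c d ht]
    have h1 : ∀ t ∈ Icc (-s₀) s₀, inCoords (modeOneFStar a s₀ c d) t (π / 2) = d * fStar a t :=
      fun t ht => by simp [inCoords_modeOneFStar a c d ht]
    rw [jacobiOperator_modeOne ha (isModeOne_modeOneFStar a s₀ c d).inCoords_eq (hev 0 c h0)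
      (hev _ d h1) (hy₂.const_mul c) (hy₂.const_mul d), h0 s hs', h1 s hs']
    rw [modeOneJacobi] at hy ⊢
    rw [modeOneJacobi]
    linear_combination (c * cos θ + d * sin θ) * hy
  · have hmem : ε * s₀ ∈ Icc (-s₀) s₀ := by
      rcases hε with rfl | rfl <;> constructor <;> linarith
    have hud := uniqueDiffOn_Icc (show -s₀ < s₀ by linarith) _ hmem
    have hd : HasDerivWithinAt (fun t => inCoords (modeOneFStar a s₀ c d) t θ)
        (c * fStarDeriv a (ε * s₀) * cos θ + d * fStarDeriv a (ε * s₀) * sin θ)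
        (Icc (-s₀) s₀) (ε * s₀) :=
      ((((hasDerivAt_fStar ha _).const_mul c).mul_const _).add
        (((hasDerivAt_fStar ha _).const_mul d).mul_const _)).hasDerivWithinAt.congr
        (fun t ht => inCoords_modeOneFStar a c d ht θ) (inCoords_modeOneFStar a c d hmem θ)
    have hr := robin_fStar ha hs₀ h
    rw [conormalDeriv_catenoid ha, hd.derivWithin hud, inCoords_modeOneFStar a c d hmem]
    rcases hε with rfl | rfl
    -- At the lower end the outward conormal reverses sign, and so does the odd function `f_*`,
    -- while `f_*'` is even.
    · rw [neg_one_mul s₀, fStarDeriv_neg, fStar_neg]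
      linear_combination -(c * cos θ + d * sin θ) * hr
    · rw [one_mul s₀]
      linear_combination (c * cos θ + d * sin θ) * hr

theorem exists_eq_modeOneFStar {a s₀ : ℝ} (ha : 1 / 2 < a) (hs₀ : 0 < s₀)
    (h : normalHeight a s₀ = 0) {n : ℕ∞} (hn : 2 ≤ n) {u : Annulus s₀ → ℝ}
    (hu : u ∈ robinEigenspace a s₀ 0 n) : ∃ c d, u = modeOneFStar a s₀ c d := by
  obtain ⟨hC, hM, hJ, hR⟩ := hu
  have hud : UniqueDiffOn ℝ (Icc (-s₀) s₀) := uniqueDiffOn_Icc (by linarith)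
  have hC2 : ∀ θ, ContDiffOn ℝ 2 (fun s => inCoords u s θ) (Icc (-s₀) s₀) := fun θ =>
    (hC.of_le (show ((2 : ℕ∞) : WithTop ℕ∞) ≤ n from WithTop.coe_le_coe.2 hn)).comp
      (contDiff_id.prodMk contDiff_const).contDiffOn
      fun s hs => ⟨hs, mem_univ θ⟩
  have hC1 : ∀ θ, ContDiffOn ℝ 1 (derivWithin (fun s => inCoords u s θ) (Icc (-s₀) s₀))
      (Icc (-s₀) s₀) := fun θ => (hC2 θ).derivWithin hud (by norm_num)
  have hder : ∀ {v : ℝ → ℝ}, ContDiffOn ℝ 1 v (Icc (-s₀) s₀) → ∀ s ∈ Ioo (-s₀) s₀,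
      HasDerivAt v (derivWithin v (Icc (-s₀) s₀) s) s := fun hv s hs =>
    ((hv.differentiableOn one_ne_zero) s (Ioo_subset_Icc_self hs)).hasDerivWithinAt.hasDerivAt
      (Icc_mem_nhds hs.1 hs.2)
  have hder0 := fun θ => hder ((hC2 θ).of_le one_le_two)
  have hder1 := fun θ => hder (hC1 θ)
  have hev : ∀ θ, ∀ s ∈ Ioo (-s₀) s₀, ∀ᶠ t in nhds s, HasDerivAt (fun s => inCoords u s θ)
      (derivWithin (fun s => inCoords u s θ) (Icc (-s₀) s₀) t) t := fun θ s hs => by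
    filter_upwards [isOpen_Ioo.mem_nhds hs] with t ht using hder0 θ t ht
  have hode := fun s hs θ => (jacobiOperator_modeOne ha hM.inCoords_eq (hev 0 s hs)
    (hev (π / 2) s hs) (hder1 0 s hs) (hder1 (π / 2) s hs) θ).symm.trans (hJ s hs θ)
  -- Both `u` and `f_*` satisfy the Robin condition at `s₀` with the same coefficient, so their
  -- Wronskian vanishes there.
  have hbd : ∀ θ, inCoords u s₀ θ * fStarDeriv a s₀ =
      derivWithin (fun s => inCoords u s θ) (Icc (-s₀) s₀) s₀ * fStar a s₀ := by
    intro θ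
    have h1 := hR 1 (by simp) θ
    rw [conormalDeriv_catenoid ha, one_mul, one_mul] at h1
    rw [h1, robin_fStar ha hs₀ h]
    ring
  obtain ⟨c, hc⟩ := eq_mul_fStar_of_modeOneJacobi_eq_zero ha hs₀ (hC2 0).continuousOn
    (hC1 0).continuousOn (hder0 0) (hder1 0)
    (fun s hs => by simpa using hode s hs 0) (hbd 0)
  obtain ⟨d, hd⟩ := eq_mul_fStar_of_modeOneJacobi_eq_zero ha hs₀ (hC2 (π / 2)).continuousOn
    (hC1 (π / 2)).continuousOn (hder0 (π / 2)) (hder1 (π / 2))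
    (fun s hs => by simpa using hode s hs (π / 2)) (hbd (π / 2))
  refine ⟨c, d, funext fun ⟨⟨s, hs⟩, θ⟩ => ?_⟩
  induction θ using Real.Angle.induction_on with
  | _ θ =>
    rw [← inCoords_of_mem u hs, ← inCoords_of_mem (modeOneFStar a s₀ c d) hs, hM.inCoords_eq,
      hc s hs, hd s hs,
      inCoords_modeOneFStar a c d hs]

/-! ### The span of the two Killing functions. -/

theorem killingJacobiOn_one_two {a : ℝ} (ha : 1 / 2 < a) (s₀ : ℝ) :
    killingJacobiOn a s₀ 1 2 = modeOneFStar a s₀ 1 0 := by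
  funext p
  simp [killingJacobiOn, killingJacobi_one_two ha, modeOneFStar]

theorem killingJacobiOn_one_three {a : ℝ} (ha : 1 / 2 < a) (s₀ : ℝ) :
    killingJacobiOn a s₀ 1 3 = modeOneFStar a s₀ 0 1 := by
  funext p
  simp [killingJacobiOn, killingJacobi_one_three ha, modeOneFStar]

theorem modeOneFStar_eq (a s₀ c d : ℝ) :
    c • modeOneFStar a s₀ 1 0 + d • modeOneFStar a s₀ 0 1 = modeOneFStar a s₀ c d := by
  funext p
  simp [modeOneFStar]
  ring

theorem linearIndependent_modeOneFStar {a s₀ : ℝ} (ha : 1 / 2 < a) (hs₀ : 0 < s₀) :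
    LinearIndependent ℝ ![modeOneFStar a s₀ 1 0, modeOneFStar a s₀ 0 1] := by
  rw [LinearIndependent.pair_iff]
  intro c d h
  rw [modeOneFStar_eq] at h
  have hs : s₀ ∈ Icc (-s₀) s₀ := ⟨by linarith, le_rfl⟩
  have hf := (fStar_pos ha hs₀).ne'
  have h1 := congrFun h (⟨s₀, hs⟩, ((0 : ℝ) : Real.Angle))
  have h2 := congrFun h (⟨s₀, hs⟩, ((π / 2 : ℝ) : Real.Angle))
  simp only [modeOneFStar, Real.Angle.cos_coe, Real.Angle.sin_coe, cos_zero, sin_zero,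
    cos_pi_div_two, sin_pi_div_two, mul_one, mul_zero, add_zero, zero_add, Pi.zero_apply,
    mul_eq_zero, hf, or_false] at h1 h2
  exact ⟨h1, h2⟩

end HypCatenoid

theorem proposition1p1 (a : ℝ) (ha : 1 / 2 < a) :
    (∃! s₀ : ℝ, HypCatenoid.IsCritical a s₀) ∧
    ∀ s₀ : ℝ, HypCatenoid.IsCritical a s₀ →
      (∀ s θ : ℝ,
        HypCatenoid.killingJacobi a 1 2 s θ = HypCatenoid.fStar a s * Real.cos θ ∧
        HypCatenoid.killingJacobi a 1 3 s θ = HypCatenoid.fStar a s * Real.sin θ) ∧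
      ∀ n : ℕ∞, 2 ≤ n →
        ∃ V : Submodule ℝ (HypCatenoid.Annulus s₀ → ℝ),
          (V : Set (HypCatenoid.Annulus s₀ → ℝ)) = HypCatenoid.robinEigenspace a s₀ 0 n ∧
          Module.finrank ℝ V = 2 ∧
          V = Submodule.span ℝ {HypCatenoid.killingJacobiOn a s₀ 1 2,
            HypCatenoid.killingJacobiOn a s₀ 1 3} := by
  -- The closing `rfl` fixes `V` as the span; its equality with the eigenspace and its dimension
  -- remain.
  refine ⟨?_, fun s₀ hs₀ => ⟨fun s θ => ⟨HypCatenoid.killingJacobi_one_two ha s θ,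
    HypCatenoid.killingJacobi_one_three ha s θ⟩, fun n hn => ⟨_, ?_, ?_, rfl⟩⟩⟩
  · simp only [HypCatenoid.isCritical_iff ha]
    exact HypCatenoid.existsUnique_normalHeight_eq_zero ha
  · obtain ⟨hpos, hν⟩ := (HypCatenoid.isCritical_iff ha s₀).1 hs₀
    rw [HypCatenoid.killingJacobiOn_one_two ha, HypCatenoid.killingJacobiOn_one_three ha]
    ext u
    rw [SetLike.mem_coe, Submodule.mem_span_pair]
    simp only [HypCatenoid.modeOneFStar_eq]
    constructor
    · rintro ⟨c, d, rfl⟩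
      exact HypCatenoid.modeOneFStar_mem_robinEigenspace ha hpos hν c d n
    · intro hu
      obtain ⟨c, d, rfl⟩ := HypCatenoid.exists_eq_modeOneFStar ha hpos hν hn hu
      exact ⟨c, d, rfl⟩
  · rw [HypCatenoid.killingJacobiOn_one_two ha, HypCatenoid.killingJacobiOn_one_three ha]
    have h := finrank_span_eq_card (HypCatenoid.linearIndependent_modeOneFStar ha hs₀.1)
    rwa [Matrix.range_cons, Matrix.range_cons, Matrix.range_empty, union_empty,
      singleton_union, Fintype.card_fin] at h
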